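/- **Expressive power of functional-calculus spectral GNNs.** *Setting.* Graphs are finite, simple and undirected, with vertex set $[N]$ and a node feature matrix $X\in\mathbb{R}^{N\times d}$, where $d\ge 0$ is fixed. Write $G\sim_{1\text{-WL}}H$ if the $1$-dimensional Weisfeiler–Leman test does not distinguish $G$ and $H$. That is, let color refinement start from the labels $\ell^{(0)}(v)=x_v$ (two nodes have the same initial label if and only if they have the same feature vector) and update by $\ell^{(t)}(v)=\mathrm{HASH}\big(\ell^{(t-1)}(v),\{\!\{\ell^{(t-1)}(u): u\in N(v)\}\!\}\big)$ with $\mathrm{HASH}$ injective; then for every $t\ge 0$ the multisets of node labels of $G$ and of $H$ after $t$ rounds agree. A *graph shift operator* $S$ assigns to every graph on $[N]$ (without features) a real symmetric matrix in $\mathbb{R}^{N\times N}$. It is an *aggregation* graph shift operator if there is one sum-aggregation message passing network, the same for all graphs, with finitely many layers of the form $x_v\mapsto\phi_t\big(x_v,\sum_{u\in N(v)}\kappa_t(x_u)\big)$, $\phi_t,\kappa_t$ continuous, that maps $f$ to $Sf$ for every graph and every signal $f\in\mathbb{R}^N$ on it. Let $\rho:\mathbb{R}\to\mathbb{R}$ be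 Lipschitz. For a graph shift operator $S$, let $\mathcal{F}_C(S)$ be the class of maps computed by spectral GNNs with finitely many layers ($L\ge 1$, arbitrary widths $d_t$, $d_0=d$) of the form $$X^{(t)}=\rho\Big(\sum_{i=1}^N v_iv_i^\top X^{(t-1)}H_t(\lambda_i)^\top+\mathbf{1}(b^{(t)})^\top\Big),\qquad X^{(0)}=X,$$ followed by the sum $\sum_v X^{(L)}_{v,\cdot}$ over all nodes. Here $S=\sum_i\lambda_iv_iv_i^\top$ is an orthonormal eigendecomposition, $H_t:\mathbb{R}\to\mathbb{R}^{d_t\times d_{t-1}}$ is continuous, $b^{(t)}\in\mathbb{R}^{d_t}$, $\rho$ acts entrywise, and $H_t$, $b^{(t)}$ do not depend on the graph. A class $\mathcal{F}$ of maps is *not more expressive than $1$-WL* if $G\sim_{1\text{-WL}}H$ implies $\Phi(G)=\Phi(H)$ for all $\Phi\in\mathcal{F}$. It is *not less expressive than $1$-WL* if $G\not\sim_{1\text{-WL}}H$ implies $\Phi(G)\ne\Phi(H)$ for some $\Phi\in\mathcal{F}$. It is *as expressive as $1$-WL* if both hold. *Claim.* 1. For every aggregation graph shift operator $S$, $\mathcal{F}_C(S)$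 is not more expressive than $1$-WL. 2. The adjacency matrix $A$ is an aggregation graph shift operator and, if $\rho$ is not affine (for example $\rho=\mathrm{ReLU}$), $\mathcal{F}_C(A)$ is as expressive as $1$-WL. 3. Consequently, if $\rho$ is not affine, the class $\bigcup_S\mathcal{F}_C(S)$, with $S$ ranging over all aggregation graph shift operators, is as expressive as $1$-WL. -/

import Mathlib

open scoped NNReal

noncomputable section

namespace SpectralGNN

/-- A finite simple graph on the vertices `0, …, order - 1`, with a feature vector in `ℝ^d` at each
vertex (row `v` of `feature` belongs to the vertex `v`). -/
structure FeaturedGraph (d : ℕ) where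
  order : ℕ
  graph : SimpleGraph (Fin order)
  feature : Matrix (Fin order) (Fin d) ℝ

/-! ### The 1-dimensional Weisfeiler–Leman test -/

/-- Labels after `t` rounds. The hash of a pair (own label, multiset of neighbor labels) is that
pair itself, so hashing is injective, and labels of different graphs can be compared. -/
def WLColor (d : ℕ) : ℕ → Type
  | 0 => Fin d → ℝ
  | t + 1 => WLColor d t × Multiset (WLColor d t)

open Classical in
/-- Color refinement, started from the vertex features. -/
def wlColor {d : ℕ} (G : FeaturedGraph d) : (t : ℕ) → Fin G.order → WLColor d t
  | 0 => fun v i => G.feature v i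
  | t + 1 => fun v => (wlColor G t v, (G.graph.neighborFinset v).val.map (wlColor G t))

/-- The multiset of all vertex labels after `t` rounds. -/
def wlHistogram {d : ℕ} (G : FeaturedGraph d) (t : ℕ) : Multiset (WLColor d t) :=
  (Finset.univ : Finset (Fin G.order)).val.map (wlColor G t)

/-- `G` and `H` are not distinguished by 1-WL at any iteration. -/
def WLEquiv {d : ℕ} (G H : FeaturedGraph d) : Prop :=
  ∀ t : ℕ, wlHistogram G t = wlHistogram H t

/-! ### Sum-aggregation message passing neural networks -/

/-- A layer `x_v ↦ φ (x_v, ∑_{u ∈ N(v)} κ (x_u))` with continuous `κ` and `φ`. -/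
structure MessageLayer (d e : ℕ) where
  msgDim : ℕ
  κ : (Fin d → ℝ) → (Fin msgDim → ℝ)
  φ : (Fin d → ℝ) × (Fin msgDim → ℝ) → (Fin e → ℝ)
  continuous_κ : Continuous κ
  continuous_φ : Continuous φ

open Classical in
def MessageLayer.apply {d e : ℕ} (ℓ : MessageLayer d e) {n : ℕ} (G : SimpleGraph (Fin n))
    (X : Matrix (Fin n) (Fin d) ℝ) : Matrix (Fin n) (Fin e) ℝ :=
  Matrix.of fun v => ℓ.φ (fun i => X v i, ∑ u ∈ G.neighborFinset v, ℓ.κ (fun i => X u i))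

/-- A nonempty finite stack of message passing layers, the first layer being outermost. -/
inductive MPNN : ℕ → ℕ → Type
  | single {d e : ℕ} (ℓ : MessageLayer d e) : MPNN d e
  | cons {d e k : ℕ} (ℓ : MessageLayer d e) (M : MPNN e k) : MPNN d k

/-- The vertex features computed by the network from the input features `X`. -/
def MPNN.apply : {d k : ℕ} → MPNN d k → {n : ℕ} → SimpleGraph (Fin n) →
    Matrix (Fin n) (Fin d) ℝ → Matrix (Fin n) (Fin k) ℝ
  | _, _, .single ℓ, _, G, X => ℓ.apply G X
  | _, _, .cons ℓ M, _, G, X => M.apply G (ℓ.apply G X)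

/-! ### Graph shift operators -/

/-- A graph shift operator: a rule that attaches a real symmetric matrix to every finite graph. -/
structure GraphShiftOperator where
  toMatrix : {n : ℕ} → SimpleGraph (Fin n) → Matrix (Fin n) (Fin n) ℝ
  isHermitian : ∀ {n : ℕ} (G : SimpleGraph (Fin n)), (toMatrix G).IsHermitian

/-- An aggregation graph shift operator: one sum-aggregation MPNN, the same for all graphs, computes
`f ↦ S f` for every graph and every scalar signal `f` on it. -/
def GraphShiftOperator.IsAggregation (S : GraphShiftOperator) : Prop :=
  ∃ M : MPNN 1 1, ∀ (n : ℕ) (G : SimpleGraph (Fin n)) (f : Fin n → ℝ),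
    M.apply G (Matrix.replicateCol (Fin 1) f) =
      Matrix.replicateCol (Fin 1) ((S.toMatrix G).mulVec f)

open Classical in
/-- The adjacency matrix as a graph shift operator. -/
def adjacencyGSO : GraphShiftOperator where
  toMatrix G := G.adjMatrix ℝ
  isHermitian G := by
    rw [Matrix.IsHermitian, Matrix.conjTranspose_eq_transpose_of_trivial]
    exact G.isSymm_adjMatrix

/-! ### Functional-calculus spectral GNNs -/

/-- The filter `H(S) X = ∑ i, v_i v_iᵀ X H(λ_i)ᵀ`, where `v_i` is an orthonormal basis of
eigenvectors of the symmetric matrix `S` and `λ_i` are the corresponding eigenvalues. -/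
def spectralFilter {n d e : ℕ} {S : Matrix (Fin n) (Fin n) ℝ} (hS : S.IsHermitian)
    (H : ℝ → Matrix (Fin e) (Fin d) ℝ) (X : Matrix (Fin n) (Fin d) ℝ) :
    Matrix (Fin n) (Fin e) ℝ :=
  ∑ i, Matrix.vecMulVec (hS.eigenvectorBasis i).ofLp (hS.eigenvectorBasis i).ofLp * X *
    (H (hS.eigenvalues i)).transpose

/-- The parameters of a layer: a continuous matrix-valued frequency response and a bias vector,
the bias being the same for all vertices. -/
structure SpectralLayer (d e : ℕ) where
  H : ℝ → Matrix (Fin e) (Fin d) ℝ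
  continuous_H : Continuous H
  bias : Fin e → ℝ

/-- The layer `X ↦ ρ (H(S) X + bias)`, with `ρ` applied to each entry. -/
def SpectralLayer.apply {d e : ℕ} (ℓ : SpectralLayer d e) (ρ : ℝ → ℝ) (S : GraphShiftOperator)
    {n : ℕ} (G : SimpleGraph (Fin n)) (X : Matrix (Fin n) (Fin d) ℝ) :
    Matrix (Fin n) (Fin e) ℝ :=
  Matrix.of fun v j => ρ (spectralFilter (S.isHermitian G) ℓ.H X v j + ℓ.bias j)

/-- A nonempty finite stack of spectral layers, the first layer being outermost. -/
inductive SpectralNet : ℕ → ℕ → Type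
  | single {d e : ℕ} (ℓ : SpectralLayer d e) : SpectralNet d e
  | cons {d e k : ℕ} (ℓ : SpectralLayer d e) (M : SpectralNet e k) : SpectralNet d k

/-- The vertex features computed by the network from the input features `X`. -/
def SpectralNet.apply (ρ : ℝ → ℝ) (S : GraphShiftOperator) :
    {d k : ℕ} → SpectralNet d k → {n : ℕ} → SimpleGraph (Fin n) →
      Matrix (Fin n) (Fin d) ℝ → Matrix (Fin n) (Fin k) ℝ
  | _, _, .single ℓ, _, G, X => ℓ.apply ρ S G X
  | _, _, .cons ℓ M, _, G, X => M.apply ρ S G (ℓ.apply ρ S G X)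

/-- The graph-level output: the sum of the final feature vectors over all vertices. -/
def SpectralNet.output {d k : ℕ} (M : SpectralNet d k) (ρ : ℝ → ℝ) (S : GraphShiftOperator)
    (G : FeaturedGraph d) : Fin k → ℝ :=
  fun j => ∑ v, M.apply ρ S G.graph G.feature v j

/-! ### Expressive power -/

/-- A map from graphs with features in `ℝ^d` to vectors of some fixed length. -/
abbrev GraphMap (d : ℕ) : Type := (k : ℕ) × (FeaturedGraph d → (Fin k → ℝ))

/-- The class of functional-calculus spectral GNNs with sum pooling, with activation `ρ` and graph
shift operator `S`, on graphs with features in `ℝ^d`. -/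
def functionalCalculusGNNs (ρ : ℝ → ℝ) (S : GraphShiftOperator) (d : ℕ) : Set (GraphMap d) :=
  {Φ | ∃ (k : ℕ) (M : SpectralNet d k), Φ = ⟨k, M.output ρ S⟩}

/-- Graphs which the test identifies get equal outputs from every member of the class. -/
def NotMoreExpressive {d : ℕ} (F : Set (GraphMap d))
    (test : FeaturedGraph d → FeaturedGraph d → Prop) : Prop :=
  ∀ G H : FeaturedGraph d, test G H → ∀ Φ ∈ F, Φ.2 G = Φ.2 H

/-- Graphs which the test distinguishes get different outputs from some member of the class. -/
def NotLessExpressive {d : ℕ} (F : Set (GraphMap d))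
    (test : FeaturedGraph d → FeaturedGraph d → Prop) : Prop :=
  ∀ G H : FeaturedGraph d, ¬ test G H → ∃ Φ ∈ F, Φ.2 G ≠ Φ.2 H

def AsExpressiveAs {d : ℕ} (F : Set (GraphMap d))
    (test : FeaturedGraph d → FeaturedGraph d → Prop) : Prop :=
  NotLessExpressive F test ∧ NotMoreExpressive F test

end SpectralGNN

end

/-! Upper bound: on two fixed graphs a filter sees only the finitely many eigenvalues, so a
polynomial interpolating the frequency response on both spectra replaces it, and the filter becomes
a polynomial in `S`. Each application of `S` is a run of a message passing network, whose values are
functions of sufficiently late WL labels (`WLInvariant.spectralLayer`). Pooling then depends only on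
the label histogram.

Lower bound: the network may depend on the pair of graphs. Inductively, its features linearly span
all functions of the round-`t` labels (`SpansColors`). An affine response in `A` then gives, before
activation, each vertex's own label indicators and the counts of its neighbors' labels, which
determine the next label. The activation has to turn this separation into spanning
(`exists_ridge_interpolation`). If ridge functions of `ρ` failed to span the functions on a finite
set, a linear relation between them would make all differences of `ρ` of some order vanish. Since
`ρ` is Lipschitz, its first differences are bounded, and this forces `ρ` to be affine. -/

noncomputable section

namespace SpectralGNN

/-! ### Ridge functions on finite sets -/

/-- All iterated forward differences of order `m` vanish. -/
def DiffVanish : ℕ → (ℝ → ℝ) → Prop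
  | 0, g => ∀ x, g x = 0
  | m + 1, g => ∀ h, DiffVanish m (fwdDiff h g)

lemma DiffVanish.succ {m : ℕ} {g : ℝ → ℝ} (hg : DiffVanish m g) : DiffVanish (m + 1) g := by
  induction m generalizing g with
  | zero => intro h x; simp [fwdDiff, hg _]
  | succ m ih => intro h; exact ih (hg h)

/-- If a sum of ridge functions vanishes identically in the weights, then each profile has vanishing
differences. -/
lemma diffVanish_of_sum_ridge_eq_zero {ι : Type*} [Fintype ι] (s : Finset (ι → ℝ)) (p : ι → ℝ) (hp : p ∉ s)
    (g : (ι → ℝ) → ℝ → ℝ)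
    (hg : ∀ (w : ι → ℝ) (b : ℝ), g p (w ⬝ᵥ p + b) + ∑ q ∈ s, g q (w ⬝ᵥ q + b) = 0) :
    DiffVanish s.card (g p) := by
  classical
  induction s using Finset.induction_on generalizing g with
  | empty =>
    intro x
    simpa using hg 0 x
  | insert r s hr ih =>
    rw [Finset.card_insert_of_notMem hr]
    intro h
    have hpr : p - r ≠ 0 := sub_ne_zero.2 fun e => hp (by simp [e])
    have hc : (p - r) ⬝ᵥ (p - r) ≠ 0 := fun e => hpr (dotProduct_self_eq_zero.1 e)
    -- Moving the weights by `u` and the bias by `-u ⬝ᵥ r` fixes the argument at `r` and shifts the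
    -- one at `p` by `h`. Subtracting the two relations eliminates `r` and replaces each other
    -- profile by a difference.
    set u : ι → ℝ := (h / ((p - r) ⬝ᵥ (p - r))) • (p - r) with hu
    have hup : u ⬝ᵥ (p - r) = h := by
      rw [hu, smul_dotProduct, smul_eq_mul, div_mul_cancel₀ _ hc]
    have key := ih (fun e => hp (Finset.mem_insert_of_mem e))
      (fun q => fwdDiff (u ⬝ᵥ (q - r)) (g q)) (fun w b => by
        have h1 := hg (w + u) (b - u ⬝ᵥ r)
        have h2 := hg w b
        have e : ∀ q : ι → ℝ,
            (w + u) ⬝ᵥ q + (b - u ⬝ᵥ r) = w ⬝ᵥ q + b + u ⬝ᵥ (q - r) := fun q => by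
          rw [add_dotProduct, dotProduct_sub]; ring
        simp only [e, Finset.sum_insert hr, sub_self, dotProduct_zero, add_zero] at h1 h2
        simp only [fwdDiff, Finset.sum_sub_distrib]
        linarith)
    simpa only [hup] using key

/-- With vanishing second differences, `f` is affine along each progression `x + n * a`, so
boundedness makes its slope zero. Higher orders reduce to this because differences of a bounded
function are bounded. -/
lemma DiffVanish.of_bounded {m : ℕ} {f : ℝ → ℝ} (hf : DiffVanish (m + 2) f) {C : ℝ}
    (hC : ∀ x, |f x| ≤ C) : DiffVanish (m + 1) f := by
  induction m generalizing f C with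
  | zero =>
    intro a x
    have hstep : ∀ n : ℕ, f (x + n * a) = f x + n * fwdDiff a f x ∧
        fwdDiff a f (x + n * a) = fwdDiff a f x := by
      intro n
      induction n with
      | zero => simp
      | succ n ih =>
        have h0 := hf a a (x + n * a)
        have e : x + ((n + 1 : ℕ) : ℝ) * a = x + n * a + a := by push_cast; ring
        have h1 : f (x + n * a + a) = f (x + n * a) + fwdDiff a f (x + n * a) := by
          simp [fwdDiff]
        have h2 : fwdDiff a f (x + n * a + a) = fwdDiff a f (x + n * a) :=
          sub_eq_zero.1 h0
        rw [e, h1, h2, ih.1, ih.2]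
        refine ⟨?_, rfl⟩
        push_cast; ring
    by_contra hne
    obtain ⟨n, hn⟩ := exists_nat_gt (2 * C / |fwdDiff a f x|)
    have hpos : 0 < |fwdDiff a f x| := abs_pos.2 hne
    rw [div_lt_iff₀ hpos] at hn
    have h1 : (n : ℝ) * fwdDiff a f x = f (x + n * a) - f x := by rw [(hstep n).1]; ring
    have h2 : (n : ℝ) * |fwdDiff a f x| = |f (x + n * a) - f x| := by
      rw [← h1, abs_mul, Nat.abs_cast]
    have h3 := abs_sub (f (x + n * a)) (f x)
    linarith [hC (x + n * a), hC x]
  | succ m ih =>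
    intro h
    refine ih (hf h) (C := C + C) fun x => ?_
    exact (abs_sub _ _).trans (add_le_add (hC _) (hC _))

lemma DiffVanish.one_of_bounded {m : ℕ} {f : ℝ → ℝ} (hf : DiffVanish (m + 1) f) {C : ℝ}
    (hC : ∀ x, |f x| ≤ C) : DiffVanish 1 f := by
  induction m with
  | zero => exact hf
  | succ m ih => exact ih (hf.of_bounded hC)

/-- The Lipschitz bound makes each first difference bounded, hence constant. Then `ρ - ρ 0` is
additive and continuous, so linear. -/
lemma DiffVanish.affine_of_lipschitz {m : ℕ} {ρ : ℝ → ℝ} (h : DiffVanish m ρ) {K : ℝ≥0}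
    (hρ : LipschitzWith K ρ) : ∃ a b : ℝ, ∀ x : ℝ, ρ x = a * x + b := by
  have h2 : DiffVanish 2 ρ := fun a =>
    -- Raising the order twice leaves order `m + 1` after one difference, which is positive even for
    -- `m = 0`.
    (h.succ.succ a).one_of_bounded (C := K * |a|) fun x => by
      have := hρ.dist_le_mul (x + a) x
      simpa [fwdDiff, Real.dist_eq] using this
  let σ : ℝ →+ ℝ :=
    { toFun := fun x => ρ x - ρ 0
      map_zero' := sub_self _
      map_add' := fun x y => by
        have := h2 x y 0
        simp only [fwdDiff, zero_add] at this
        rw [add_comm x y]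
        linarith }
  have hσ : Continuous σ := hρ.continuous.sub continuous_const
  refine ⟨σ 1, ρ 0, fun x => ?_⟩
  have := map_real_smul σ hσ x 1
  have e : σ x = ρ x - ρ 0 := rfl
  rw [smul_eq_mul, mul_one, smul_eq_mul, e] at this
  linarith

/-- For a Lipschitz activation that is not affine, finitely many ridge functions span all
functions on a given finite set. -/
lemma exists_ridge_interpolation {ρ : ℝ → ℝ} {K : ℝ≥0} (hρ : LipschitzWith K ρ)
    (hna : ¬ ∃ a b : ℝ, ∀ x : ℝ, ρ x = a * x + b) {ι : Type*} [Fintype ι]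
    (s : Finset (ι → ℝ)) :
    ∃ (k : ℕ) (W : Matrix (Fin k) ι ℝ) (b : Fin k → ℝ), ∀ F : (ι → ℝ) → ℝ,
      ∃ a : Fin k → ℝ, ∀ x ∈ s, ∑ j, a j * ρ (W.mulVec x j + b j) = F x := by
  classical
  let r : (ι → ℝ) × ℝ → (s → ℝ) := fun q x => ρ (q.1 ⬝ᵥ x.1 + q.2)
  have hspan : Submodule.span ℝ (Set.range r) = ⊤ := by
    by_contra hne
    -- A nonzero functional killing the span is a relation among the ridge functions; a nonzero
    -- coefficient `c p` makes `c p * ρ` affine.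
    obtain ⟨f, hf0, hf⟩ := Submodule.exists_le_ker_of_lt_top _ (lt_top_iff_ne_top.2 hne)
    apply hf0
    refine LinearMap.pi_ext' fun p => LinearMap.ext_ring ?_
    by_contra hcp
    let c : (ι → ℝ) → ℝ := fun q => if hq : q ∈ s then f (Pi.single ⟨q, hq⟩ 1) else 0
    have hsum : ∀ (w : ι → ℝ) (b : ℝ), ∑ q ∈ s, c q * ρ (w ⬝ᵥ q + b) = 0 := by
      intro w b
      have h0 : f (r (w, b)) = 0 := hf (Submodule.subset_span ⟨(w, b), rfl⟩)
      rw [LinearMap.pi_apply_eq_sum_univ f] at h0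
      rw [← h0, ← Finset.sum_coe_sort s]
      refine Finset.sum_congr rfl fun q _ => ?_
      have e : (fun j => if q = j then (1 : ℝ) else 0) = Pi.single q 1 := by
        ext j; simp [Pi.single_apply, eq_comm]
      simp [c, r, e, mul_comm]
    have hd : DiffVanish (s.erase p.1).card (fun x => c p.1 * ρ x) :=
      diffVanish_of_sum_ridge_eq_zero (s.erase p.1) p.1 (by simp) (fun q x => c q * ρ x)
        fun w b => by rw [Finset.add_sum_erase s (fun q => c q * ρ (w ⬝ᵥ q + b)) p.2, hsum]
    have hcp' : c p.1 ≠ 0 := by simpa [c] using hcp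
    have hL : LipschitzWith (‖c p.1‖₊ * K) (fun x => c p.1 * ρ x) :=
      (lipschitzWith_smul (c p.1)).comp hρ
    obtain ⟨a, b, hab⟩ := hd.affine_of_lipschitz hL
    refine hna ⟨a / c p.1, b / c p.1, fun x => ?_⟩
    have := hab x
    field_simp
    linarith
  obtain ⟨f, hfr, hf, -⟩ := Submodule.exists_fun_fin_finrank_span_eq ℝ (Set.range r)
  choose q hq using hfr
  refine ⟨_, Matrix.of fun j => (q j).1, fun j => (q j).2, fun F => ?_⟩
  have hF : (fun x : s => F x.1) ∈ Submodule.span ℝ (Set.range f) := by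
    rw [hf, hspan]; trivial
  obtain ⟨a, ha⟩ := (Submodule.mem_span_range_iff_exists_fun ℝ).1 hF
  refine ⟨a, fun x hx => ?_⟩
  have := congrFun ha ⟨x, hx⟩
  simpa [← hq, r, Matrix.mulVec] using this

/-! ### Polynomial filters -/

section Filter

variable {n d e : ℕ} {S : Matrix (Fin n) (Fin n) ℝ} (hS : S.IsHermitian)

/-- The orthogonal projection onto the line of the `i`-th eigenvector. -/
def eigenprojection (i : Fin n) : Matrix (Fin n) (Fin n) ℝ :=
  Matrix.vecMulVec (hS.eigenvectorBasis i).ofLp (hS.eigenvectorBasis i).ofLp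

lemma sum_eigenprojection : ∑ i, eigenprojection hS i = 1 := by
  have h := Unitary.coe_mul_star_self hS.eigenvectorUnitary
  rw [← h]
  ext a b
  simp [eigenprojection, Matrix.sum_apply, Matrix.vecMulVec_apply, Matrix.mul_apply,
    Matrix.star_apply, Matrix.IsHermitian.eigenvectorUnitary_apply]

lemma mul_eigenprojection (i : Fin n) :
    S * eigenprojection hS i = hS.eigenvalues i • eigenprojection hS i := by
  rw [eigenprojection, Matrix.mul_vecMulVec, hS.mulVec_eigenvectorBasis, Matrix.smul_vecMulVec]

lemma aeval_mul_eigenprojection (p : Polynomial ℝ) (i : Fin n) :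
    Polynomial.aeval S p * eigenprojection hS i =
      p.eval (hS.eigenvalues i) • eigenprojection hS i := by
  induction p using Polynomial.induction_on' with
  | add p q hp hq => simp [add_mul, add_smul, hp, hq]
  | monomial k a =>
    have hk : S ^ k * eigenprojection hS i = hS.eigenvalues i ^ k • eigenprojection hS i := by
      induction k with
      | zero => simp
      | succ k ih =>
        rw [pow_succ, mul_assoc, mul_eigenprojection, Matrix.mul_smul, ih, smul_smul, pow_succ,
          mul_comm]
    rw [Polynomial.aeval_monomial, Polynomial.eval_monomial, mul_assoc, hk,
      ← Algebra.smul_def, smul_smul]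

lemma sum_eval_smul_eigenprojection (p : Polynomial ℝ) :
    ∑ i, p.eval (hS.eigenvalues i) • eigenprojection hS i = Polynomial.aeval S p := by
  simp_rw [← aeval_mul_eigenprojection, ← Finset.mul_sum, sum_eigenprojection, mul_one]

lemma spectralFilter_apply (H : ℝ → Matrix (Fin e) (Fin d) ℝ) (X : Matrix (Fin n) (Fin d) ℝ)
    (v : Fin n) (j : Fin e) :
    spectralFilter hS H X v j =
      ∑ k, ((∑ i, H (hS.eigenvalues i) j k • eigenprojection hS i).mulVec (X.col k)) v := by
  simp only [spectralFilter, Matrix.sum_apply, Matrix.mul_apply, Matrix.transpose_apply,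
    Matrix.mulVec, dotProduct, Matrix.smul_apply, smul_eq_mul, Finset.sum_mul, eigenprojection,
    Matrix.col_apply]
  rw [Finset.sum_comm]
  refine Finset.sum_congr rfl fun k _ => ?_
  rw [Finset.sum_comm]
  refine Finset.sum_congr rfl fun u _ => Finset.sum_congr rfl fun i _ => ?_
  ring

/-- Only the values of `H` on the spectrum enter the filter, and `∑ i, p(λ_i) v_i v_iᵀ = p(S)`. -/
lemma spectralFilter_eq_of_eval (H : ℝ → Matrix (Fin e) (Fin d) ℝ)
    (p : Fin e → Fin d → Polynomial ℝ)
    (hp : ∀ i j k, (p j k).eval (hS.eigenvalues i) = H (hS.eigenvalues i) j k)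
    (X : Matrix (Fin n) (Fin d) ℝ) (v : Fin n) (j : Fin e) :
    spectralFilter hS H X v j =
      ∑ k, ((Polynomial.aeval S (p j k)).mulVec (X.col k)) v := by
  rw [spectralFilter_apply]
  simp_rw [← hp, sum_eval_smul_eigenprojection]

/-- An affine frequency response acts by one shift. -/
lemma spectralFilter_affine (B C : Matrix (Fin e) (Fin d) ℝ) (X : Matrix (Fin n) (Fin d) ℝ) :
    spectralFilter hS (fun x => B + x • C) X = X * B.transpose + S * X * C.transpose := by
  ext v j
  rw [spectralFilter_eq_of_eval hS _
    (fun j k => Polynomial.C (B j k) + Polynomial.X * Polynomial.C (C j k))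
    (fun i j k => by simp; ring)]
  have h : ∀ k, (Polynomial.aeval S
      (Polynomial.C (B j k) + Polynomial.X * Polynomial.C (C j k))) = B j k • 1 + C j k • S := by
    intro k
    simp [Algebra.algebraMap_eq_smul_one]
  simp_rw [h, Matrix.add_mulVec, Matrix.smul_mulVec, Matrix.one_mulVec]
  simp only [Pi.add_apply, Pi.smul_apply, smul_eq_mul, Finset.sum_add_distrib, Matrix.add_apply,
    Matrix.mul_apply, Matrix.transpose_apply, Matrix.mulVec, dotProduct, Matrix.col_apply]
  congr 1 <;> exact Finset.sum_congr rfl fun k _ => mul_comm _ _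

end Filter

/-! ### The upper bound -/

section Invariant

variable {d : ℕ} {G H : FeaturedGraph d} {α β : Type*}

/-- The two families of vertex values are given by one and the same function of the labels of
color refinement, for all sufficiently late rounds. -/
def WLInvariant (G H : FeaturedGraph d) (f : Fin G.order → α) (g : Fin H.order → α) : Prop :=
  ∀ᶠ t in Filter.atTop, ∃ F : WLColor d t → α,
    (∀ v, f v = F (wlColor G t v)) ∧ ∀ v, g v = F (wlColor H t v)

/-- A label carries its predecessor as first component, so a function of round-`t` labels is one of
all later labels. This gives several invariants a common round. -/
lemma WLInvariant.of_round {f : Fin G.order → α} {g : Fin H.order → α} {t : ℕ}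
    (h : ∃ F : WLColor d t → α, (∀ v, f v = F (wlColor G t v)) ∧ ∀ v, g v = F (wlColor H t v)) :
    WLInvariant G H f g := by
  refine Filter.eventually_atTop.2 ⟨t, fun s hs => ?_⟩
  induction s, hs using Nat.le_induction with
  | base => exact h
  | succ s _ ih =>
    obtain ⟨F, hf, hg⟩ := ih
    exact ⟨fun c => F c.1, hf, hg⟩

lemma WLInvariant.comp {f : Fin G.order → α} {g : Fin H.order → α} (h : WLInvariant G H f g)
    (φ : α → β) : WLInvariant G H (fun v => φ (f v)) (fun v => φ (g v)) :=
  h.mono fun _ ⟨F, hf, hg⟩ => ⟨fun c => φ (F c), fun v => congrArg φ (hf v), fun v => congrArg φ (hg v)⟩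

lemma WLInvariant.prodMk {f : Fin G.order → α} {g : Fin H.order → α}
    {f' : Fin G.order → β} {g' : Fin H.order → β}
    (h : WLInvariant G H f g) (h' : WLInvariant G H f' g') :
    WLInvariant G H (fun v => (f v, f' v)) (fun v => (g v, g' v)) := by
  filter_upwards [h, h'] with t ⟨F, hf, hg⟩ ⟨F', hf', hg'⟩
  exact ⟨fun c => (F c, F' c), fun v => by rw [hf, hf'], fun v => by rw [hg, hg']⟩

lemma WLInvariant.pi {ι : Type*} [Finite ι] {f : Fin G.order → ι → α} {g : Fin H.order → ι → α}
    (h : ∀ i, WLInvariant G H (fun v => f v i) (fun v => g v i)) : WLInvariant G H f g := by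
  filter_upwards [Filter.eventually_all.2 h] with t ht
  choose F hf hg using ht
  exact ⟨fun c i => F i c, fun v => funext fun i => hf i v, fun v => funext fun i => hg i v⟩

open Classical in
-- The second component of the next label is the multiset of neighbor labels, so the neighbor sum
-- can be read off at the cost of one round.
lemma WLInvariant.sum_neighbors [AddCommMonoid α] {f : Fin G.order → α} {g : Fin H.order → α}
    (h : WLInvariant G H f g) :
    WLInvariant G H (fun v => ∑ u ∈ G.graph.neighborFinset v, f u)
      (fun v => ∑ u ∈ H.graph.neighborFinset v, g u) := by
  obtain ⟨t, F, hf, hg⟩ := h.exists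
  refine WLInvariant.of_round (t := t + 1) ⟨fun c => (c.2.map F).sum, fun v => ?_, fun v => ?_⟩
  · simp only [wlColor, Multiset.map_map, Function.comp_def, ← hf]; rfl
  · simp only [wlColor, Multiset.map_map, Function.comp_def, ← hg]; rfl

lemma WLInvariant.messageLayer {a b : ℕ} (ℓ : MessageLayer a b)
    {X : Matrix (Fin G.order) (Fin a) ℝ} {Y : Matrix (Fin H.order) (Fin a) ℝ}
    (h : WLInvariant G H X Y) :
    WLInvariant G H (ℓ.apply G.graph X) (ℓ.apply H.graph Y) :=
  (h.prodMk (h.comp ℓ.κ).sum_neighbors).comp ℓ.φ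

lemma WLInvariant.mpnn {a b : ℕ} (M : MPNN a b)
    {X : Matrix (Fin G.order) (Fin a) ℝ} {Y : Matrix (Fin H.order) (Fin a) ℝ}
    (h : WLInvariant G H X Y) :
    WLInvariant G H (M.apply G.graph X) (M.apply H.graph Y) := by
  induction M with
  | single ℓ => exact h.messageLayer ℓ
  | cons ℓ M ih => exact ih (h.messageLayer ℓ)

variable {S : GraphShiftOperator}

lemma WLInvariant.shift (hS : S.IsAggregation) {f : Fin G.order → ℝ} {g : Fin H.order → ℝ}
    (h : WLInvariant G H f g) :
    WLInvariant G H ((S.toMatrix G.graph).mulVec f) ((S.toMatrix H.graph).mulVec g) := by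
  obtain ⟨M, hM⟩ := hS
  have hX : WLInvariant G H (Matrix.replicateCol (Fin 1) f) (Matrix.replicateCol (Fin 1) g) :=
    h.comp fun x (_ : Fin 1) => x
  have := hX.mpnn M
  rw [hM, hM] at this
  exact this.comp fun x => x 0

lemma WLInvariant.aeval (hS : S.IsAggregation) (p : Polynomial ℝ)
    {f : Fin G.order → ℝ} {g : Fin H.order → ℝ} (h : WLInvariant G H f g) :
    WLInvariant G H ((Polynomial.aeval (S.toMatrix G.graph) p).mulVec f)
      ((Polynomial.aeval (S.toMatrix H.graph) p).mulVec g) := by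
  induction p using Polynomial.induction_on' with
  | add p q hp hq =>
    simp only [map_add, Matrix.add_mulVec]
    exact (hp.prodMk hq).comp fun x => x.1 + x.2
  | monomial k a =>
    induction k generalizing f g with
    | zero =>
      simp only [Polynomial.aeval_monomial, pow_zero, mul_one, Algebra.algebraMap_eq_smul_one,
        Matrix.smul_mulVec, Matrix.one_mulVec]
      exact h.comp fun x => a • x
    | succ k ih =>
      have := ih (h.shift hS)
      simpa only [Polynomial.aeval_monomial, pow_succ, Matrix.mulVec_mulVec, mul_assoc] using this

/-- The interpolation of the frequency response on the two spectra by polynomials turns a spectral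
layer into a polynomial in the shift operator. -/
lemma WLInvariant.spectralLayer (hS : S.IsAggregation) (ρ : ℝ → ℝ) {a b : ℕ}
    (ℓ : SpectralLayer a b)
    {X : Matrix (Fin G.order) (Fin a) ℝ} {Y : Matrix (Fin H.order) (Fin a) ℝ}
    (h : WLInvariant G H X Y) :
    WLInvariant G H (ℓ.apply ρ S G.graph X) (ℓ.apply ρ S H.graph Y) := by
  classical
  -- Interpolation is on the union of the spectra because the same polynomial must serve both
  -- graphs.
  let nodes : Finset ℝ := Finset.univ.image (S.isHermitian G.graph).eigenvalues ∪
    Finset.univ.image (S.isHermitian H.graph).eigenvalues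
  let p : Fin b → Fin a → Polynomial ℝ := fun j k =>
    Lagrange.interpolate nodes id fun x => ℓ.H x j k
  have hp : ∀ x ∈ nodes, ∀ j k, (p j k).eval x = ℓ.H x j k := fun x hx j k =>
    Lagrange.eval_interpolate_at_node (v := id) (fun x => ℓ.H x j k) Function.injective_id.injOn hx
  refine WLInvariant.pi fun j => ?_
  simp only [SpectralLayer.apply, Matrix.of_apply]
  refine WLInvariant.comp (f := fun v => spectralFilter (S.isHermitian G.graph) ℓ.H X v j)
    (g := fun v => spectralFilter (S.isHermitian H.graph) ℓ.H Y v j) ?_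
    fun x => ρ (x + ℓ.bias j)
  have hG := fun v => spectralFilter_eq_of_eval (S.isHermitian G.graph) ℓ.H p
    (fun i => hp _ (by simp [nodes])) X v j
  have hH := fun v => spectralFilter_eq_of_eval (S.isHermitian H.graph) ℓ.H p
    (fun i => hp _ (by simp [nodes])) Y v j
  simp only [hG, hH]
  exact (WLInvariant.pi fun k => (h.comp fun x => x k).aeval hS (p j k)).comp fun x => ∑ k, x k

lemma WLInvariant.spectralNet (hS : S.IsAggregation) (ρ : ℝ → ℝ) {a b : ℕ} (M : SpectralNet a b)
    {X : Matrix (Fin G.order) (Fin a) ℝ} {Y : Matrix (Fin H.order) (Fin a) ℝ}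
    (h : WLInvariant G H X Y) :
    WLInvariant G H (M.apply ρ S G.graph X) (M.apply ρ S H.graph Y) := by
  induction M with
  | single ℓ => exact h.spectralLayer hS ρ ℓ
  | cons ℓ M ih => exact ih (h.spectralLayer hS ρ ℓ)

lemma WLInvariant.sum_eq [AddCommMonoid α] {f : Fin G.order → α} {g : Fin H.order → α}
    (h : WLInvariant G H f g) (hGH : WLEquiv G H) : ∑ v, f v = ∑ v, g v := by
  obtain ⟨t, F, hf, hg⟩ := h.exists
  have := congrArg (fun m => (m.map F).sum) (hGH t)
  simp only [wlHistogram, Multiset.map_map, Function.comp_def, ← hf, ← hg] at this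
  exact this

lemma wlInvariant_feature (G H : FeaturedGraph d) : WLInvariant G H G.feature H.feature :=
  WLInvariant.of_round (t := 0) ⟨fun c => c, fun _ => rfl, fun _ => rfl⟩

end Invariant

theorem notMoreExpressive_of_isAggregation (ρ : ℝ → ℝ) {S : GraphShiftOperator}
    (hS : S.IsAggregation) (d : ℕ) :
    NotMoreExpressive (functionalCalculusGNNs ρ S d) WLEquiv := by
  rintro G H hGH _ ⟨k, M, rfl⟩
  funext j
  exact (((wlInvariant_feature G H).spectralNet hS ρ M).comp fun x => x j).sum_eq hGH

theorem adjacencyGSO_isAggregation : adjacencyGSO.IsAggregation := by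
  classical
  refine ⟨.single ⟨1, id, Prod.snd, continuous_id, continuous_snd⟩, fun n G f => ?_⟩
  ext v i
  simp only [MPNN.apply, MessageLayer.apply, Matrix.of_apply, adjacencyGSO,
    Matrix.replicateCol_apply, SimpleGraph.adjMatrix_mulVec_apply, Finset.sum_apply, id]

/-! ### The lower bound -/

/-- The network `M` followed by one more layer. -/
def SpectralNet.snoc : {d e k : ℕ} → SpectralNet d e → SpectralLayer e k → SpectralNet d k
  | _, _, _, .single ℓ, ℓ' => .cons ℓ (.single ℓ')
  | _, _, _, .cons ℓ M, ℓ' => .cons ℓ (M.snoc ℓ')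

lemma SpectralNet.apply_snoc (ρ : ℝ → ℝ) (S : GraphShiftOperator) {d e k : ℕ}
    (M : SpectralNet d e) (ℓ : SpectralLayer e k) {n : ℕ} (G : SimpleGraph (Fin n))
    (X : Matrix (Fin n) (Fin d) ℝ) :
    (M.snoc ℓ).apply ρ S G X = ℓ.apply ρ S G (M.apply ρ S G X) := by
  induction M with
  | single => rfl
  | cons ℓ₀ M ih => exact ih ℓ _

section Separation

variable {d : ℕ} (G H : FeaturedGraph d)

/-- Color refinement on the disjoint union of the two vertex sets. -/
def jointColor (t : ℕ) : Fin G.order ⊕ Fin H.order → WLColor d t :=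
  Sum.elim (wlColor G t) (wlColor H t)

variable {G H}

lemma jointColor_succ_fst (t : ℕ) (v : Fin G.order ⊕ Fin H.order) :
    (jointColor G H (t + 1) v).1 = jointColor G H t v := by
  cases v <;> rfl

open Classical in
lemma mem_range_of_mem_jointColor_succ {t : ℕ} {v : Fin G.order ⊕ Fin H.order}
    {c : WLColor d t} (hc : c ∈ (jointColor G H (t + 1) v).2) :
    c ∈ Set.range (jointColor G H t) := by
  rcases v with v | v
  · obtain ⟨u, -, rfl⟩ := Multiset.mem_map.1 
      (show c ∈ (G.graph.neighborFinset v).val.map (wlColor G t) from hc)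
    exact ⟨.inl u, rfl⟩
  · obtain ⟨u, -, rfl⟩ := Multiset.mem_map.1 
      (show c ∈ (H.graph.neighborFinset v).val.map (wlColor H t) from hc)
    exact ⟨.inr u, rfl⟩

/-- Every function of the labels after `t` rounds is a linear function of the given vertex
features. -/
def SpansColors (G H : FeaturedGraph d) (t : ℕ) {k : ℕ} (X : Matrix (Fin G.order) (Fin k) ℝ)
    (Y : Matrix (Fin H.order) (Fin k) ℝ) : Prop :=
  ∀ F : WLColor d t → ℝ, ∃ a : Fin k → ℝ, (∀ v, X v ⬝ᵥ a = F (wlColor G t v)) ∧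
    ∀ v, Y v ⬝ᵥ a = F (wlColor H t v)

/-- The argument of the activation in a layer with an affine frequency response. -/
def preactivation {n k : ℕ} {ι : Type*} (G : SimpleGraph (Fin n)) (B C : Matrix ι (Fin k) ℝ)
    (X : Matrix (Fin n) (Fin k) ℝ) : Matrix (Fin n) ι ℝ :=
  X * B.transpose + adjacencyGSO.toMatrix G * X * C.transpose

/-- Once the preactivations separate the labels, every function of the labels is a function of the
preactivation on a finite set. The weights `W` of the interpolating ridge functions are absorbed
into the frequency response as `W * B + x • (W * C)`. -/
lemma exists_layer_spansColors {ρ : ℝ → ℝ} {K : ℝ≥0} (hρ : LipschitzWith K ρ)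
    (hna : ¬ ∃ a b : ℝ, ∀ x : ℝ, ρ x = a * x + b)
    {t k : ℕ} {ι : Type*} [Fintype ι] (B C : Matrix ι (Fin k) ℝ)
    (X : Matrix (Fin G.order) (Fin k) ℝ) (Y : Matrix (Fin H.order) (Fin k) ℝ)
    (hsep : (jointColor G H t).FactorsThrough
      (Matrix.fromRows (preactivation G.graph B C X) (preactivation H.graph B C Y))) :
    ∃ (e : ℕ) (ℓ : SpectralLayer k e), SpansColors G H t
      (ℓ.apply ρ adjacencyGSO G.graph X) (ℓ.apply ρ adjacencyGSO H.graph Y) := by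
  classical
  set Z : Fin G.order ⊕ Fin H.order → ι → ℝ :=
    Matrix.fromRows (preactivation G.graph B C X) (preactivation H.graph B C Y)
  obtain ⟨e, W, b, hW⟩ := exists_ridge_interpolation hρ hna (Finset.univ.image Z)
  have hact : ∀ {n : ℕ} (G : SimpleGraph (Fin n)) (X : Matrix (Fin n) (Fin k) ℝ) (v : Fin n)
      (j : Fin e), spectralFilter (adjacencyGSO.isHermitian G)
        (fun x => W * B + x • (W * C)) X v j = W.mulVec (preactivation G B C X v) j := by
    intro n G X v j
    have : X * (W * B).transpose + adjacencyGSO.toMatrix G * X * (W * C).transpose =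
        preactivation G B C X * W.transpose := by
      simp only [preactivation, Matrix.transpose_mul, Matrix.add_mul, Matrix.mul_assoc]
    rw [spectralFilter_affine, this]
    simp only [Matrix.mul_apply, Matrix.mulVec, dotProduct, Matrix.transpose_apply, mul_comm]
  refine ⟨e, ⟨fun x => W * B + x • (W * C), by fun_prop, b⟩, fun F => ?_⟩
  -- By `hsep` the function of labels descends to the image of `Z`. The default value `0` outside
  -- this image plays no role, as all interpolation nodes lie in it.
  obtain ⟨a, ha⟩ := hW (Function.extend Z (fun v => F (jointColor G H t v)) 0)
  have hext : ∀ v, ∑ j, a j * ρ (W.mulVec (Z v) j + b j) = F (jointColor G H t v) := fun v => by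
    rw [ha _ (Finset.mem_image_of_mem _ (Finset.mem_univ v)),
      Function.FactorsThrough.extend_apply fun _ _ h => congrArg F (hsep h)]
  refine ⟨a, fun v => ?_, fun v => ?_⟩
  · rw [dotProduct_comm, dotProduct]
    simp only [SpectralLayer.apply, Matrix.of_apply, hact]
    exact hext (.inl v)
  · rw [dotProduct_comm, dotProduct]
    simp only [SpectralLayer.apply, Matrix.of_apply, hact]
    exact hext (.inr v)

lemma preactivation_apply {n k : ℕ} {ι : Type*} (G : SimpleGraph (Fin n))
    (B C : Matrix ι (Fin k) ℝ) (X : Matrix (Fin n) (Fin k) ℝ) (v : Fin n) (i : ι) :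
    preactivation G B C X v i =
      X v ⬝ᵥ B i + (adjacencyGSO.toMatrix G).mulVec (fun u => X u ⬝ᵥ C i) v := by
  simp only [preactivation, Matrix.add_apply, Matrix.mul_assoc]
  rfl

open Classical in
lemma adjacency_mulVec_indicator (t : ℕ) (c : WLColor d t) (v : Fin G.order) :
    (adjacencyGSO.toMatrix G.graph).mulVec (fun u => if wlColor G t u = c then 1 else 0) v =
      ((wlColor G (t + 1) v).2.count c : ℝ) := by
  simp only [adjacencyGSO, SimpleGraph.adjMatrix_mulVec_apply, Finset.sum_boole, wlColor,
    Multiset.count_map]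
  simp only [eq_comm (a := c)]
  rfl

lemma exists_layer_spansColors_succ {ρ : ℝ → ℝ} {K : ℝ≥0} (hρ : LipschitzWith K ρ)
    (hna : ¬ ∃ a b : ℝ, ∀ x : ℝ, ρ x = a * x + b)
    {t k : ℕ} {X : Matrix (Fin G.order) (Fin k) ℝ}
    {Y : Matrix (Fin H.order) (Fin k) ℝ} (h : SpansColors G H t X Y) :
    ∃ (e : ℕ) (ℓ : SpectralLayer k e), SpansColors G H (t + 1)
      (ℓ.apply ρ adjacencyGSO G.graph X) (ℓ.apply ρ adjacencyGSO H.graph Y) := by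
  classical
  choose a haX haY using fun c : WLColor d t => h fun c' => if c' = c then 1 else 0
  -- Left coordinates read a vertex's own label indicators, right ones the neighbor counts after one
  -- shift. Only labels that occur are indexed, which keeps the width finite.
  let B : Matrix (Set.range (jointColor G H t) ⊕ Set.range (jointColor G H t)) (Fin k) ℝ :=
    Sum.elim (fun c => a c) 0
  let C : Matrix (Set.range (jointColor G H t) ⊕ Set.range (jointColor G H t)) (Fin k) ℝ :=
    Sum.elim 0 (fun c => a c)
  have : Fintype (Set.range (jointColor G H t)) := Fintype.ofFinite _
  refine exists_layer_spansColors hρ hna B C X Y ?_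
  set Z : Matrix (Fin G.order ⊕ Fin H.order) _ ℝ :=
    Matrix.fromRows (preactivation G.graph B C X) (preactivation H.graph B C Y)
  have hBl : ∀ c, B (.inl c) = a c := fun _ => rfl
  have hBr : ∀ c, B (.inr c) = 0 := fun _ => rfl
  have hCl : ∀ c, C (.inl c) = 0 := fun _ => rfl
  have hCr : ∀ c, C (.inr c) = a c := fun _ => rfl
  have hzero : ∀ {n : ℕ} (A : Matrix (Fin n) (Fin n) ℝ), A.mulVec (fun _ => (0 : ℝ)) = 0 :=
    fun A => A.mulVec_zero
  have hl : ∀ v c, Z v (.inl c) = if jointColor G H t v = c then 1 else 0 := by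
    rintro (v | v) c
    · refine (preactivation_apply G.graph B C X v (.inl c)).trans ?_
      simp only [hBl, hCl, haX, dotProduct_zero, hzero, Pi.zero_apply, add_zero]
      rfl
    · refine (preactivation_apply H.graph B C Y v (.inl c)).trans ?_
      simp only [hBl, hCl, haY, dotProduct_zero, hzero, Pi.zero_apply, add_zero]
      rfl
  have hr : ∀ v c, Z v (.inr c) = ((jointColor G H (t + 1) v).2.count c.1 : ℝ) := by
    rintro (v | v) c
    · refine (preactivation_apply G.graph B C X v (.inr c)).trans ?_
      simp only [hBr, hCr, haX, dotProduct_zero, zero_add, adjacency_mulVec_indicator]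
      rfl
    · refine (preactivation_apply H.graph B C Y v (.inr c)).trans ?_
      simp only [hBr, hCr, haY, dotProduct_zero, zero_add, adjacency_mulVec_indicator]
      rfl
  intro v w hvw
  refine Prod.ext ?_ (Multiset.ext.2 fun c => ?_)
  · have h1 := congrFun hvw (.inl ⟨_, v, rfl⟩)
    rw [hl, hl, if_pos rfl] at h1
    rw [jointColor_succ_fst, jointColor_succ_fst]
    by_contra hne
    rw [if_neg fun e => hne e.symm] at h1
    exact one_ne_zero h1
  · by_cases hc : c ∈ Set.range (jointColor G H t)
    · have h1 := congrFun hvw (.inr ⟨c, hc⟩)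
      rw [hr, hr] at h1
      exact_mod_cast h1
    · rw [Multiset.count_eq_zero_of_notMem fun e => hc (mem_range_of_mem_jointColor_succ e),
        Multiset.count_eq_zero_of_notMem fun e => hc (mem_range_of_mem_jointColor_succ e)]

lemma exists_net_spansColors {ρ : ℝ → ℝ} {K : ℝ≥0} (hρ : LipschitzWith K ρ)
    (hna : ¬ ∃ a b : ℝ, ∀ x : ℝ, ρ x = a * x + b)
    (G H : FeaturedGraph d) (t : ℕ) :
    ∃ (k : ℕ) (M : SpectralNet d k), SpansColors G H t
      (M.apply ρ adjacencyGSO G.graph G.feature) (M.apply ρ adjacencyGSO H.graph H.feature) := by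
  induction t with
  | zero =>
    -- The raw features separate the initial labels but need not span functions of them, so a first
    -- layer without shift is needed.
    obtain ⟨k, ℓ, hℓ⟩ := exists_layer_spansColors (t := 0) hρ hna 1 0 G.feature H.feature (by
      have e : ∀ {n : ℕ} (G : SimpleGraph (Fin n)) (X : Matrix (Fin n) (Fin d) ℝ),
          preactivation G 1 0 X = X := fun G X => by simp [preactivation]
      rw [e, e]
      rintro (v | v) (w | w) h <;> exact h)
    exact ⟨k, .single ℓ, hℓ⟩
  | succ t ih =>
    obtain ⟨k, M, hM⟩ := ih
    obtain ⟨e, ℓ, hℓ⟩ := exists_layer_spansColors_succ hρ hna hM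
    refine ⟨e, M.snoc ℓ, ?_⟩
    simpa only [SpectralNet.apply_snoc] using hℓ

theorem notLessExpressive_adjacency {ρ : ℝ → ℝ} {K : ℝ≥0} (hρ : LipschitzWith K ρ)
    (hna : ¬ ∃ a b : ℝ, ∀ x : ℝ, ρ x = a * x + b)
    (d : ℕ) :
    NotLessExpressive (functionalCalculusGNNs ρ adjacencyGSO d) WLEquiv := by
  classical
  intro G H hGH
  obtain ⟨t, ht⟩ := not_forall.1 hGH
  obtain ⟨k, M, hM⟩ := exists_net_spansColors hρ hna G H t
  refine ⟨_, ⟨k, M, rfl⟩, fun hout => ht (Multiset.ext.2 fun c => ?_)⟩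
  -- The readout `a` is not part of the network: being linear, it commutes with pooling, so equal
  -- outputs would give equal counts of the label `c`.
  obtain ⟨a, haG, haH⟩ := hM fun c' => if c' = c then 1 else 0
  have key : ∀ G : FeaturedGraph d,
      (∀ v, M.apply ρ adjacencyGSO G.graph G.feature v ⬝ᵥ a = if wlColor G t v = c then 1 else 0) →
      M.output ρ adjacencyGSO G ⬝ᵥ a = ((wlHistogram G t).count c : ℝ) := by
    intro G hG
    have : M.output ρ adjacencyGSO G ⬝ᵥ a =
        ∑ v, M.apply ρ adjacencyGSO G.graph G.feature v ⬝ᵥ a := by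
      simp only [SpectralNet.output, dotProduct, Finset.sum_mul]
      exact Finset.sum_comm
    rw [this]
    simp only [hG, Finset.sum_boole, wlHistogram, Multiset.count_map, eq_comm (a := c)]
    rfl
  have h := key G haG
  rw [show M.output ρ adjacencyGSO G = M.output ρ adjacencyGSO H from hout, key H haH] at h
  exact_mod_cast h.symm

end Separation

end SpectralGNN

end

theorem mainTheorem1 (ρ : ℝ → ℝ) (K : ℝ≥0) (hρ : LipschitzWith K ρ) (d : ℕ) :
    -- upper bound, for every aggregation graph shift operator
    (∀ S : SpectralGNN.GraphShiftOperator, S.IsAggregation →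
      SpectralGNN.NotMoreExpressive (SpectralGNN.functionalCalculusGNNs ρ S d)
        SpectralGNN.WLEquiv) ∧
    -- the adjacency matrix is an aggregation graph shift operator
    SpectralGNN.adjacencyGSO.IsAggregation ∧
    -- exact separation power, for every activation that is not affine
    ((¬ ∃ a b : ℝ, ∀ x : ℝ, ρ x = a * x + b) →
      SpectralGNN.AsExpressiveAs
        (SpectralGNN.functionalCalculusGNNs ρ SpectralGNN.adjacencyGSO d)
        SpectralGNN.WLEquiv ∧
      SpectralGNN.AsExpressiveAs
        (⋃ S ∈ {S : SpectralGNN.GraphShiftOperator | S.IsAggregation},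
          SpectralGNN.functionalCalculusGNNs ρ S d)
        SpectralGNN.WLEquiv) := by
  open SpectralGNN in
  refine ⟨fun S hS => notMoreExpressive_of_isAggregation ρ hS d, adjacencyGSO_isAggregation,
    fun hna => ⟨⟨notLessExpressive_adjacency hρ hna d,
      notMoreExpressive_of_isAggregation ρ adjacencyGSO_isAggregation d⟩, ?_, ?_⟩⟩
  · intro G H hGH
    obtain ⟨Φ, hΦ, hne⟩ := notLessExpressive_adjacency hρ hna d G H hGH
    exact ⟨Φ, Set.mem_biUnion adjacencyGSO_isAggregation hΦ, hne⟩
  · intro G H hGH Φ hΦ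
    obtain ⟨S, hS, hΦS⟩ := Set.mem_iUnion₂.1 hΦ
    exact notMoreExpressive_of_isAggregation ρ hS d G H hGH Φ hΦS
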